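/- Let $n$ be a natural number and let $R=\mathbb{C}[x_1,\dots,x_n]$ carry its standard grading, with the symmetric group $S_n$ permuting the variables. Call homogeneous polynomials $f_1,\dots,f_n\in R$ a (maximal) homogeneous regular sequence if their only common zero in $\mathbb{C}^n$ is the origin. Let $d_1,\dots,d_n$ be positive integers for which there is a homogeneous regular sequence $f_1,\dots,f_n$ consisting of symmetric polynomials ($f_j\in R^{S_n}$) with $\deg f_j=d_j$ for all $j$. Then: 1. the rational function $\displaystyle\prod_{i=1}^n\frac{1-t^{d_i}}{1-t^i}$ is a polynomial in $t$ with nonnegative integer coefficients; 2. for every integer $i\ge 1$, the number $\beta_i=\#\{1\le j\le n : i\mid d_j\}$ satisfies $\beta_i\ge\lfloor n/i\rfloor$; 3. $n!$ divides $\prod_{j=1}^n d_j$. -/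

import Mathlib

/-- A maximal homogeneous regular sequence in `ℂ[x₁, …, xₙ]`: `n` homogeneous polynomials
`f₁, …, fₙ`, with `fⱼ` of degree `dⱼ`, whose only common zero in `ℂⁿ` is the origin. -/
structure IsMaximalRegularSequence {n : ℕ} (f : Fin n → MvPolynomial (Fin n) ℂ)
    (d : Fin n → ℕ) : Prop where
  homogeneous : ∀ j, (f j).IsHomogeneous (d j)
  common_zero : ∀ x : Fin n → ℂ, (∀ j, MvPolynomial.eval x (f j) = 0) ↔ x = 0

/-- A regular degree sequence: a sequence `(d₁, …, dₙ)` of positive integers for which there is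
a homogeneous regular sequence `f₁, …, fₙ` of symmetric polynomials with `deg fⱼ = dⱼ`. -/
def IsRegularDegreeSequence {n : ℕ} (d : Fin n → ℕ) : Prop :=
  (∀ j, 0 < d j) ∧ ∃ f : Fin n → MvPolynomial (Fin n) ℂ,
    (∀ j, (f j).IsSymmetric) ∧ IsMaximalRegularSequence f d

/-- `βᵢ`, the number of indices `j` such that `i` divides `dⱼ`. -/
def degreeBeta {n : ℕ} (d : Fin n → ℕ) (i : ℕ) : ℕ :=
  (Finset.univ.filter fun j : Fin n => i ∣ d j).card

/-!
Write each `fⱼ` as a polynomial `gⱼ` in the elementary symmetric polynomials. Then `g₁, …, gₙ` are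
forms of degrees `dⱼ` in the polynomial ring `A` whose variables have weights `1, …, n`, and their
only common zero is the origin, because every point of `ℂⁿ` is the tuple of elementary symmetric
functions of some point. The polynomial asked for in the first claim is the Hilbert series of the
finite-dimensional ring `A / (g₁, …, gₙ)`. The second claim compares the multiplicities of a
primitive `i`-th root of unity as a root of the two products, and the third one evaluates at `1`
after cancelling `(1 - t) ^ n`.

The heart of the matter is `MvPolynomial.IsParameterFamily.exists_prod_one_sub_eq`: forms
`g₁, …, gₙ` whose only common zero is the origin are a regular sequence, so that the Hilbert series
of the quotient is `∏ (1 - t ^ dⱼ) / ∏ (1 - t ^ wⱼ)`. Instead of Cohen–Macaulay theory, the proof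
deforms the variables `x₁, …, xₙ` into `g₁, …, gₙ`, changing one form at a time.

* Regularity is encoded numerically, by the Hilbert series of the quotient
  (`MvPolynomial.IsHilbertRegular`). Since all series involved have nonnegative coefficients, this
  condition forces every form of the family to be a non-zero-divisor modulo the others, and any form
  may be exchanged for another non-zero-divisor (`MvPolynomial.IsHilbertRegular.exchange`).
* If the common zero locus stays trivial when `c` is exchanged for `c'`, then, modulo the other
  forms, a power of `c` is a multiple of `c'` by the Nullstellensatz, so `c'` is a non-zero-divisor
  when `c` is (`MvPolynomial.IsHilbertRegular.exchange_of_isParameterFamily`).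
* In a pencil `h + s c` of forms of equal degree all but finitely many members can take the place of
  `c` without creating new common zeros (`MvPolynomial.IsParameterFamily.finite_not_update`). Given
  two families, this yields a form which can replace the `i`-th member of both; after one such step
  for every `i` the two families are connected
  (`MvPolynomial.IsHilbertRegular.of_isParameterFamily`).
-/

namespace MvPolynomial

attribute [local instance] weightedGradedAlgebra

variable {K : Type*} [Field K] {σ ι : Type*} {w : σ → ℕ}

/-! ### Hilbert functions of quotients of a weighted polynomial ring -/

lemma weightedHomogeneousComponent_mul {c : MvPolynomial σ K} {δ : ℕ}
    (hc : c.IsWeightedHomogeneous w δ) (a : MvPolynomial σ K) (k : ℕ) :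
    weightedHomogeneousComponent w k (c * a) =
      if δ ≤ k then c * weightedHomogeneousComponent w (k - δ) a else 0 := by
  classical
  induction a using MvPolynomial.induction_on' with
  | add p q hp hq =>
    rw [mul_add, map_add, map_add, hp, hq]
    split_ifs
    · rw [mul_add]
    · rw [add_zero]
  | monomial u r =>
    have hu : (monomial u r : MvPolynomial σ K).IsWeightedHomogeneous w (Finsupp.weight w u) :=
      isWeightedHomogeneous_monomial w u r rfl
    rw [weightedHomogeneousComponent_of_mem (hc.mul hu), weightedHomogeneousComponent_of_mem hu]
    split_ifs with h1 h2 h3 h4 h5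
    · rfl
    · omega
    · omega
    · omega
    · simp
    · rfl

/-- The Hilbert function of `K[x] / I`, where `I` need not be homogeneous: the dimension of the
image in the quotient of the space of polynomials of weighted degree `k`. -/
noncomputable def hilbertFunction (w : σ → ℕ) (I : Ideal (MvPolynomial σ K)) (k : ℕ) : ℕ :=
  Module.finrank K ((weightedHomogeneousSubmodule K w k).map (Ideal.Quotient.mkₐ K I).toLinearMap)

/-- The Hilbert series of `K[x] / I`, the generating function of its Hilbert function. -/
noncomputable def hilbertSeries (w : σ → ℕ) (I : Ideal (MvPolynomial σ K)) : PowerSeries ℕ :=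
  PowerSeries.mk (hilbertFunction w I)

lemma finrank_map_add_finrank_inf_ker {V W : Type*} [AddCommGroup V] [Module K V]
    [AddCommGroup W] [Module K W] (f : V →ₗ[K] W) (U : Submodule K V) [FiniteDimensional K U] :
    Module.finrank K (U.map f) + Module.finrank K (U ⊓ LinearMap.ker f : Submodule K V) =
      Module.finrank K U := by
  have h := (f.domRestrict U).finrank_range_add_finrank_ker
  rw [LinearMap.range_domRestrict, LinearMap.ker_domRestrict] at h
  rw [← h]
  congr 1
  rw [← Submodule.map_comap_subtype]
  exact LinearEquiv.finrank_eq (Submodule.equivSubtypeMap _ _).symm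

lemma finiteDimensional_weightedHomogeneousSubmodule [Finite σ] (hw : ∀ i, w i ≠ 0) (k : ℕ) :
    FiniteDimensional K (weightedHomogeneousSubmodule K w k) :=
  Module.Finite.of_fg (weightedHomogeneousSubmodule_fg K w hw k)

lemma hilbertFunction_eq_zero_of_le {I : Ideal (MvPolynomial σ K)} {k : ℕ}
    (h : ∀ p : MvPolynomial σ K, p.IsWeightedHomogeneous w k → p ∈ I) :
    hilbertFunction w I k = 0 := by
  have : (weightedHomogeneousSubmodule K w k).map (Ideal.Quotient.mkₐ K I).toLinearMap = ⊥ := by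
    rw [eq_bot_iff]
    rintro _ ⟨p, hp, rfl⟩
    exact Ideal.Quotient.eq_zero_iff_mem.2 (h p hp)
  rw [hilbertFunction, this, finrank_bot]

/-- The effect on Hilbert series of adding a form `c` of degree `δ` to a homogeneous ideal `I`:
the exact sequence `K[x]/I → K[x]/I → K[x]/(I + (c)) → 0` given by multiplication by `c`. The
series `E` counts the kernel of this multiplication. -/
theorem exists_hilbertSeries_sup_span_singleton [Finite σ] (hw : ∀ i, w i ≠ 0)
    {I : Ideal (MvPolynomial σ K)} (hI : I.IsHomogeneous (weightedHomogeneousSubmodule K w))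
    {c : MvPolynomial σ K} {δ : ℕ} (hc : c.IsWeightedHomogeneous w δ) :
    ∃ E : PowerSeries ℕ,
      hilbertSeries w (I ⊔ Ideal.span {c}) + PowerSeries.X ^ δ * hilbertSeries w I =
        hilbertSeries w I + PowerSeries.X ^ δ * E ∧
      (E = 0 ↔ ∀ p, c * p ∈ I → p ∈ I) := by
  classical
  set I' := I ⊔ Ideal.span {c} with hI'
  have hle : I ≤ I' := le_sup_left
  have hfin := fun k => finiteDimensional_weightedHomogeneousSubmodule (K := K) hw k
  set V : ℕ → Submodule K (MvPolynomial σ K ⧸ I) := fun k =>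
    (weightedHomogeneousSubmodule K w k).map (Ideal.Quotient.mkₐ K I).toLinearMap with hV
  set f : (MvPolynomial σ K ⧸ I) →ₗ[K] (MvPolynomial σ K ⧸ I') :=
    (Ideal.Quotient.factorₐ K hle).toLinearMap with hf
  set m : (MvPolynomial σ K ⧸ I) →ₗ[K] (MvPolynomial σ K ⧸ I) :=
    LinearMap.mulLeft K (Ideal.Quotient.mk I c) with hm
  have hV' : ∀ k, hilbertFunction w I' k = Module.finrank K ((V k).map f) := by
    intro k
    rw [hilbertFunction, hV, ← Submodule.map_comp]
    rfl
  have hker : ∀ k, ∀ p : MvPolynomial σ K, p.IsWeightedHomogeneous w k → p ∈ I' →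
      ∃ a, p - (if δ ≤ k then c * weightedHomogeneousComponent w (k - δ) a else 0) ∈ I := by
    intro k p hp hpI
    obtain ⟨y, hy, z, hz, rfl⟩ := Submodule.mem_sup.1 hpI
    obtain ⟨a, rfl⟩ := Ideal.mem_span_singleton'.1 hz
    refine ⟨a, ?_⟩
    have h1 := weightedHomogeneousComponent_mem_of_mem K w hI hy k
    rw [mul_comm a c] at hp ⊢
    rw [← weightedHomogeneousComponent_mul hc]
    have h2 := weightedHomogeneousComponent_eq_self hp
    rw [map_add] at h2
    rw [← h2, add_sub_cancel_right]
    exact h1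
  -- The kernel of `K[x]/I → K[x]/I'` in degree `k` is zero for `k < δ`, and otherwise the image
  -- under multiplication by `c` of the part of degree `k - δ`.
  have hlow : ∀ k, k < δ → V k ⊓ LinearMap.ker f = ⊥ := by
    intro k hk
    rw [eq_bot_iff]
    rintro _ ⟨⟨p, hp, rfl⟩, hpk⟩
    have hpI : p ∈ I' := Ideal.Quotient.eq_zero_iff_mem.1 hpk
    obtain ⟨a, ha⟩ := hker k p hp hpI
    rw [if_neg (by omega), sub_zero] at ha
    exact Ideal.Quotient.eq_zero_iff_mem.2 ha
  have hhigh : ∀ k, V (k + δ) ⊓ LinearMap.ker f = (V k).map m := by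
    intro k
    apply le_antisymm
    · rintro _ ⟨⟨p, hp, rfl⟩, hpk⟩
      have hpI : p ∈ I' := Ideal.Quotient.eq_zero_iff_mem.1 hpk
      obtain ⟨a, ha⟩ := hker _ p hp hpI
      rw [if_pos (by omega), Nat.add_sub_cancel] at ha
      refine ⟨_, ⟨_, weightedHomogeneousComponent_mem w a k, rfl⟩, ?_⟩
      exact (Ideal.Quotient.eq.2 ha).symm
    · rintro _ ⟨_, ⟨p, hp, rfl⟩, rfl⟩
      refine ⟨⟨c * p, ?_, rfl⟩, ?_⟩
      · rw [add_comm]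
        exact hc.mul hp
      · exact Ideal.Quotient.eq_zero_iff_mem.2
          (Ideal.mul_mem_right _ _ (le_sup_right (a := I) (Ideal.mem_span_singleton_self c)))
  refine ⟨PowerSeries.mk fun k => Module.finrank K (V k ⊓ LinearMap.ker m :
    Submodule K (MvPolynomial σ K ⧸ I)), ?_, ?_⟩
  · ext k
    simp only [map_add, PowerSeries.coeff_X_pow_mul', hilbertSeries, PowerSeries.coeff_mk]
    rw [hV' k]
    change _ + (if δ ≤ k then Module.finrank K (V (k - δ)) else 0) = Module.finrank K (V k) + _
    have h1 := finrank_map_add_finrank_inf_ker f (V k)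
    split_ifs with hk
    · obtain ⟨j, rfl⟩ := Nat.exists_eq_add_of_le' hk
      rw [Nat.add_sub_cancel]
      rw [hhigh] at h1
      have h2 := finrank_map_add_finrank_inf_ker m (V j)
      omega
    · rw [hlow k (by omega), finrank_bot] at h1
      omega
  · have hE : ∀ k, Module.finrank K (V k ⊓ LinearMap.ker m :
        Submodule K (MvPolynomial σ K ⧸ I)) = 0 ↔
        ∀ p : MvPolynomial σ K, p.IsWeightedHomogeneous w k → c * p ∈ I → p ∈ I := by
      intro k
      have : FiniteDimensional K (V k ⊓ LinearMap.ker m :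
        Submodule K (MvPolynomial σ K ⧸ I)) := Submodule.finiteDimensional_inf_left _ _
      rw [Submodule.finrank_eq_zero, eq_bot_iff]
      constructor
      · intro h p hp hcp
        exact Ideal.Quotient.eq_zero_iff_mem.1
          (h ⟨⟨p, hp, rfl⟩, Ideal.Quotient.eq_zero_iff_mem.2 hcp⟩)
      · rintro h _ ⟨⟨p, hp, rfl⟩, hpk⟩
        exact Ideal.Quotient.eq_zero_iff_mem.2 (h p hp (Ideal.Quotient.eq_zero_iff_mem.1 hpk))
    constructor
    · intro h p hp
      rw [mem_iff_weightedHomogeneousComponent_mem K w hI]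
      intro k
      refine (hE k).1 ?_ _ (weightedHomogeneousComponent_isWeightedHomogeneous k p) ?_
      · simpa using congrArg (PowerSeries.coeff k) h
      · have := weightedHomogeneousComponent_mem_of_mem K w hI hp (k + δ)
        rwa [weightedHomogeneousComponent_mul hc, if_pos (by omega),
          Nat.add_sub_cancel] at this
    · intro h
      ext k
      rw [PowerSeries.coeff_mk, (hE k).2 fun p _ => h p, map_zero]

/-! ### Regular families of forms through their Hilbert series -/

/-- For `δ > 0`, the power series `1 / (1 - X ^ δ) = 1 + X ^ δ + X ^ (2 * δ) + ⋯`. -/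
noncomputable def geomSeries (δ : ℕ) : PowerSeries ℕ :=
  PowerSeries.mk fun k => if δ ∣ k then 1 else 0

lemma geomSeries_eq {δ : ℕ} (hδ : 0 < δ) :
    geomSeries δ = 1 + PowerSeries.X ^ δ * geomSeries δ := by
  ext k
  simp only [geomSeries, map_add, PowerSeries.coeff_X_pow_mul', PowerSeries.coeff_mk,
    PowerSeries.coeff_one]
  rcases lt_or_ge k δ with h | h
  · rw [if_neg (not_le.2 h), add_zero]
    rcases Nat.eq_zero_or_pos k with rfl | hk
    · simp
    · rw [if_neg (Nat.not_dvd_of_pos_of_lt hk h), if_neg hk.ne']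
  · have hk : k ≠ 0 := by omega
    have : δ ∣ k ↔ δ ∣ k - δ := by
      conv_lhs => rw [← Nat.sub_add_cancel h]
      simp
    simp only [this, if_pos h, if_neg hk, zero_add]

lemma geomSeries_ne_zero (δ : ℕ) : geomSeries δ ≠ 0 := by
  intro h
  simpa [geomSeries] using congrArg (PowerSeries.coeff 0) h

lemma powerSeries_add_left_cancel {a b c : PowerSeries ℕ} (h : a + b = a + c) : b = c := by
  ext k
  simpa using congrArg (PowerSeries.coeff k) h

/-- `exists_hilbertSeries_sup_span_singleton` divided by `1 - X ^ δ`; all terms now have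
nonnegative coefficients. -/
lemma exists_geomSeries_mul_hilbertSeries [Finite σ] (hw : ∀ i, w i ≠ 0)
    {I : Ideal (MvPolynomial σ K)} (hI : I.IsHomogeneous (weightedHomogeneousSubmodule K w))
    {c : MvPolynomial σ K} {δ : ℕ} (hδ : 0 < δ) (hc : c.IsWeightedHomogeneous w δ) :
    ∃ E : PowerSeries ℕ,
      geomSeries δ * hilbertSeries w (I ⊔ Ideal.span {c}) =
        hilbertSeries w I + PowerSeries.X ^ δ * geomSeries δ * E ∧
      (E = 0 ↔ ∀ p, c * p ∈ I → p ∈ I) := by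
  obtain ⟨E, hE, hE'⟩ := exists_hilbertSeries_sup_span_singleton hw hI hc
  refine ⟨E, ?_, hE'⟩
  apply powerSeries_add_left_cancel (a := PowerSeries.X ^ δ * geomSeries δ * hilbertSeries w I)
  have h := congrArg (geomSeries δ * ·) hE
  simp only [mul_add] at h
  have h3 : geomSeries δ * hilbertSeries w I =
      hilbertSeries w I + PowerSeries.X ^ δ * geomSeries δ * hilbertSeries w I := by
    conv_lhs => rw [geomSeries_eq hδ]
    ring
  rw [h3] at h
  calc _ = geomSeries δ * hilbertSeries w (I ⊔ Ideal.span {c}) +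
        geomSeries δ * (PowerSeries.X ^ δ * hilbertSeries w I) := by ring
    _ = _ := h
    _ = _ := by ring

lemma isHomogeneous_span_image {δ : ι → ℕ} {c : ι → MvPolynomial σ K}
    (hc : ∀ i, (c i).IsWeightedHomogeneous w (δ i)) (T : Set ι) :
    (Ideal.span (c '' T)).IsHomogeneous (weightedHomogeneousSubmodule K w) := by
  apply Ideal.homogeneous_span
  rintro _ ⟨i, -, rfl⟩
  exact ⟨δ i, hc i⟩

lemma span_image_insert {R : Type*} [CommRing R] (c : ι → R) (i : ι) (T : Set ι) :
    Ideal.span (c '' insert i T) = Ideal.span (c '' T) ⊔ Ideal.span {c i} := by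
  rw [Set.image_insert_eq, Ideal.span_insert, sup_comm]

/-- For any family of forms the Hilbert series of the quotient is at least the one that a regular
sequence would give, in the sense that the difference `N` has nonnegative coefficients after
multiplication by `∏ 1 / (1 - X ^ δᵢ)`. -/
lemma exists_prod_geomSeries_mul_hilbertSeries [Finite σ] (hw : ∀ i, w i ≠ 0)
    {δ : ι → ℕ} {c : ι → MvPolynomial σ K} (hδ : ∀ i, 0 < δ i)
    (hc : ∀ i, (c i).IsWeightedHomogeneous w (δ i)) (T : Finset ι) :
    ∃ N : PowerSeries ℕ,
      (∏ i ∈ T, geomSeries (δ i)) * hilbertSeries w (Ideal.span (c '' (T : Set ι))) =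
        hilbertSeries w (⊥ : Ideal (MvPolynomial σ K)) + N := by
  classical
  induction T using Finset.induction_on with
  | empty => exact ⟨0, by simp⟩
  | insert i T hi ih =>
    obtain ⟨N, hN⟩ := ih
    obtain ⟨E, hE, -⟩ := exists_geomSeries_mul_hilbertSeries hw
      (isHomogeneous_span_image hc (T : Set ι)) (hδ i) (hc i)
    refine ⟨N + (∏ j ∈ T, geomSeries (δ j)) * (PowerSeries.X ^ δ i * geomSeries (δ i) * E), ?_⟩
    rw [Finset.prod_insert hi, Finset.coe_insert, span_image_insert, ← add_assoc, ← hN, ← mul_add,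
      ← hE]
    ring

/-- A family `c` of forms of degrees `δ` is Hilbert regular if the Hilbert series of the quotient
by `c` is `∏ (1 - X ^ δᵢ)` times that of the polynomial ring. This numerical condition is
equivalent to `c` being a regular sequence, in any order. -/
def IsHilbertRegular [Fintype ι] (w : σ → ℕ) (δ : ι → ℕ) (c : ι → MvPolynomial σ K) : Prop :=
  (∏ i, geomSeries (δ i)) * hilbertSeries w (Ideal.span (Set.range c)) =
    hilbertSeries w (⊥ : Ideal (MvPolynomial σ K))

/-- One member of a Hilbert regular family may be exchanged for any non-zero-divisor modulo the
other members. -/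
theorem IsHilbertRegular.exchange [Finite σ] [Fintype ι] (hw : ∀ i, w i ≠ 0)
    {δ δ' : ι → ℕ} {c c' : ι → MvPolynomial σ K}
    (hδ : ∀ i, 0 < δ i) (hc : ∀ i, (c i).IsWeightedHomogeneous w (δ i))
    (hδ' : ∀ i, 0 < δ' i) (hc' : ∀ i, (c' i).IsWeightedHomogeneous w (δ' i))
    (i : ι) (hδδ' : ∀ j, j ≠ i → δ j = δ' j) (hcc' : ∀ j, j ≠ i → c j = c' j)
    (h : IsHilbertRegular w δ c)
    (hreg : (∀ p, c i * p ∈ Ideal.span (c '' {i}ᶜ) → p ∈ Ideal.span (c '' {i}ᶜ)) →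
      ∀ p, c' i * p ∈ Ideal.span (c '' {i}ᶜ) → p ∈ Ideal.span (c '' {i}ᶜ)) :
    IsHilbertRegular w δ' c' := by
  classical
  have hJ : c '' {i}ᶜ = c' '' {i}ᶜ := Set.image_congr fun j hj => hcc' j hj
  have hprod : ∏ j ∈ {i}ᶜ, geomSeries (δ j) = ∏ j ∈ {i}ᶜ, geomSeries (δ' j) :=
    Finset.prod_congr rfl fun j hj => by rw [hδδ' j (by simpa using hj)]
  have hspan : ∀ b : ι → MvPolynomial σ K,
      Ideal.span (Set.range b) = Ideal.span (b '' {i}ᶜ) ⊔ Ideal.span {b i} := by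
    intro b
    rw [← span_image_insert, Set.insert_eq, Set.union_compl_self, Set.image_univ]
  obtain ⟨N, hN⟩ := exists_prod_geomSeries_mul_hilbertSeries hw hδ hc ({i}ᶜ)
  obtain ⟨E, hE, hE0⟩ := exists_geomSeries_mul_hilbertSeries hw
    (isHomogeneous_span_image hc {i}ᶜ) (hδ i) (hc i)
  obtain ⟨E', hE', hE0'⟩ := exists_geomSeries_mul_hilbertSeries hw
    (isHomogeneous_span_image hc {i}ᶜ) (hδ' i) (hc' i)
  rw [Finset.coe_compl, Finset.coe_singleton] at hN
  rw [IsHilbertRegular, hspan, Fintype.prod_eq_mul_prod_compl i, mul_comm (geomSeries _),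
    mul_assoc] at h ⊢
  rw [hE, mul_add, hN, add_assoc] at h
  -- The coefficients are natural numbers, so both error terms in `h` vanish.
  have h0 : N + (∏ j ∈ {i}ᶜ, geomSeries (δ j)) *
      (PowerSeries.X ^ δ i * geomSeries (δ i) * E) = 0 :=
    powerSeries_add_left_cancel (h.trans (add_zero _).symm)
  have hNE : N = 0 ∧ (∏ j ∈ {i}ᶜ, geomSeries (δ j)) *
      (PowerSeries.X ^ δ i * geomSeries (δ i) * E) = 0 := by
    constructor <;> ext k <;> have := congrArg (PowerSeries.coeff k) h0 <;>
      rw [map_add, map_zero] at this <;> rw [map_zero] <;> omega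
  have hEz : E = 0 := by
    have hX : (PowerSeries.X : PowerSeries ℕ) ^ δ i ≠ 0 := pow_ne_zero _ PowerSeries.X_ne_zero
    simpa [Finset.prod_eq_zero_iff, geomSeries_ne_zero, hX] using hNE.2
  rw [← hJ, hE', hE0'.2 (hreg (hE0.1 hEz)), mul_zero, add_zero, ← hprod, hN, hNE.1, add_zero]

/-! ### Families of forms without nontrivial common zeros -/

/-- A family of forms `cᵢ` of positive weighted degrees `δᵢ` with no common zero except possibly
the origin. When there are as many forms as variables, this is a homogeneous system of
parameters. -/
structure IsParameterFamily (w : σ → ℕ) (δ : ι → ℕ) (c : ι → MvPolynomial σ K) : Prop where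
  pos : ∀ i, 0 < δ i
  homogeneous : ∀ i, (c i).IsWeightedHomogeneous w (δ i)
  eq_zero_of_eval : ∀ x : σ → K, (∀ i, eval x (c i) = 0) → x = 0

lemma IsWeightedHomogeneous.eval_zero_eq_zero {c : MvPolynomial σ K} {δ : ℕ}
    (hc : c.IsWeightedHomogeneous w δ) (hδ : 0 < δ) : eval 0 c = 0 := by
  rw [eval_zero, constantCoeff_eq]
  by_contra h
  have := hc h
  rw [map_zero] at this
  omega

/-- The Nullstellensatz for an ideal whose zero locus is at most the origin. -/
lemma IsParameterFamily.exists_pow_mem [IsAlgClosed K] [Finite σ] {δ : ι → ℕ}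
    {c : ι → MvPolynomial σ K} (h : IsParameterFamily w δ c) {p : MvPolynomial σ K}
    (hp : eval 0 p = 0) : ∃ N, p ^ N ∈ Ideal.span (Set.range c) := by
  change p ∈ (Ideal.span (Set.range c)).radical
  rw [← vanishingIdeal_zeroLocus_eq_radical (K := K), mem_vanishingIdeal_iff]
  intro x hx
  have hx0 : x = 0 := by
    apply h.eq_zero_of_eval
    intro i
    exact hx _ (Ideal.subset_span ⟨i, rfl⟩)
  rw [hx0]
  exact hp

/-- The quotient by a parameter family vanishes in large degrees. -/
lemma IsParameterFamily.exists_forall_mem [IsAlgClosed K] [Finite σ] {δ : ι → ℕ}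
    {c : ι → MvPolynomial σ K} (h : IsParameterFamily w δ c) :
    ∃ k₀, ∀ k, k₀ ≤ k → ∀ p : MvPolynomial σ K, p.IsWeightedHomogeneous w k →
      p ∈ Ideal.span (Set.range c) := by
  classical
  have := Fintype.ofFinite σ
  have hX : ∀ i : σ, ∃ N, (X i : MvPolynomial σ K) ^ N ∈ Ideal.span (Set.range c) := fun i =>
    h.exists_pow_mem (by simp)
  choose N hN using hX
  -- A monomial of larger weight than `∏ xᵢ ^ Nᵢ` is divisible by one of the `xᵢ ^ Nᵢ`.
  refine ⟨∑ i, N i * w i + 1, fun k hk p hp => ?_⟩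
  rw [p.as_sum]
  refine Ideal.sum_mem _ fun u hu => ?_
  have hwu : Finsupp.weight w u = k := hp (mem_support_iff.1 hu)
  have hex : ∃ i, N i ≤ u i := by
    by_contra! hlt
    rw [Finsupp.weight_apply, Finsupp.sum_fintype _ _ (by simp)] at hwu
    have : ∑ i, u i • w i ≤ ∑ i, N i * w i :=
      Finset.sum_le_sum fun i _ => Nat.mul_le_mul_right _ (hlt i).le
    omega
  obtain ⟨i, hi⟩ := hex
  have : monomial u (coeff u p) =
      monomial (u - Finsupp.single i (N i)) (coeff u p) * X i ^ N i := by
    rw [X_pow_eq_monomial, monomial_mul, mul_one, tsub_add_cancel_of_le]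
    simpa using hi
  rw [this]
  exact Ideal.mul_mem_left _ _ (hN i)

/-- Exchanging one member of a Hilbert regular family keeps it Hilbert regular as long as the
common zero locus stays trivial: by the Nullstellensatz a power of the old member is a multiple
of the new one modulo the other members, so the new one is a non-zero-divisor as well. -/
theorem IsHilbertRegular.exchange_of_isParameterFamily [IsAlgClosed K] [Finite σ] [Fintype ι]
    (hw : ∀ i, w i ≠ 0) {δ δ' : ι → ℕ} {c c' : ι → MvPolynomial σ K}
    (hc : IsParameterFamily w δ c) (hc' : IsParameterFamily w δ' c')
    (i : ι) (hδδ' : ∀ j, j ≠ i → δ j = δ' j) (hcc' : ∀ j, j ≠ i → c j = c' j)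
    (h : IsHilbertRegular w δ c) : IsHilbertRegular w δ' c' := by
  refine h.exchange hw hc.pos hc.homogeneous hc'.pos hc'.homogeneous i hδδ' hcc' ?_
  have hJ : c '' {i}ᶜ = c' '' {i}ᶜ := Set.image_congr fun j hj => hcc' j hj
  set J := Ideal.span (c '' {i}ᶜ) with hJdef
  intro hreg p hp
  obtain ⟨N, hN⟩ := hc'.exists_pow_mem ((hc.homogeneous i).eval_zero_eq_zero (hc.pos i))
  have hspan : Ideal.span (Set.range c') = J ⊔ Ideal.span {c' i} := by
    rw [hJdef, hJ, ← span_image_insert, Set.insert_eq, Set.union_compl_self, Set.image_univ]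
  have hmem : c i ^ N * p ∈ J := by
    rw [hspan] at hN
    obtain ⟨y, hy, z, hz, hyz⟩ := Submodule.mem_sup.1 hN
    obtain ⟨a, rfl⟩ := Ideal.mem_span_singleton'.1 hz
    rw [← hyz, add_mul, mul_assoc]
    exact J.add_mem (J.mul_mem_right _ hy) (J.mul_mem_left _ hp)
  clear hN
  induction N with
  | zero => simpa using hmem
  | succ N ih =>
    refine ih (hreg _ ?_)
    rwa [← mul_assoc, ← pow_succ']

/-- Modulo all members but one of a parameter family, the quotient ring is at most
one-dimensional, so its Hilbert function is bounded along multiples of the degree of the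
omitted member. -/
lemma IsParameterFamily.exists_hilbertFunction_le [IsAlgClosed K] [Finite σ] {δ : ι → ℕ}
    {c : ι → MvPolynomial σ K} (h : IsParameterFamily w δ c) (hw : ∀ i, w i ≠ 0) (i : ι) :
    ∃ r, hilbertFunction w (Ideal.span (c '' {i}ᶜ)) (r * δ i) ≤ r := by
  set J := Ideal.span (c '' {i}ᶜ) with hJ
  have hspan : Ideal.span (Set.range c) = J ⊔ Ideal.span {c i} := by
    rw [hJ, ← span_image_insert, Set.insert_eq, Set.union_compl_self, Set.image_univ]
  obtain ⟨k₀, hk₀⟩ := h.exists_forall_mem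
  obtain ⟨E, hE, -⟩ := exists_hilbertSeries_sup_span_singleton hw
    (isHomogeneous_span_image h.homogeneous {i}ᶜ) (h.homogeneous i)
  rw [← hspan] at hE
  have hstep : ∀ k, k₀ ≤ k →
      hilbertFunction w J (k + δ i) ≤ hilbertFunction w J k := by
    intro k hk
    have h1 := congrArg (PowerSeries.coeff (k + δ i)) hE
    simp only [map_add, PowerSeries.coeff_X_pow_mul, hilbertSeries, PowerSeries.coeff_mk] at h1
    rw [← hJ] at h1
    -- In degrees from `k₀` on, `J + (c i)` contains all forms.
    rw [hilbertFunction_eq_zero_of_le (hk₀ (k + δ i) (by omega))] at h1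
    omega
  have hbound : ∀ m, hilbertFunction w J ((k₀ + m) * δ i) ≤ hilbertFunction w J (k₀ * δ i) := by
    intro m
    induction m with
    | zero => rfl
    | succ m ih =>
      refine le_trans ?_ ih
      rw [← add_assoc, add_one_mul]
      exact hstep _ (le_trans (Nat.le_add_right _ _) (Nat.le_mul_of_pos_right _ (h.pos i)))
  exact ⟨k₀ + hilbertFunction w J (k₀ * δ i), (hbound _).trans (Nat.le_add_left _ _)⟩

/-- In the pencil spanned by a member `cᵢ` of a parameter family and a form `h` of the same degree,
all but finitely many members `h + s cᵢ` can take the place of `cᵢ`. Indeed, by the bound on the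
Hilbert function, some nonzero binary form `∑ αₐ hᵃ cᵢʳ⁻ᵃ` vanishes on the common zero locus of the
other members, and `s` only has to avoid the slopes of its zeros. -/
theorem IsParameterFamily.finite_not_update [IsAlgClosed K] [Finite σ] [DecidableEq ι]
    {δ : ι → ℕ} {c : ι → MvPolynomial σ K} (hc : IsParameterFamily w δ c) (hw : ∀ i, w i ≠ 0)
    (i : ι) {h : MvPolynomial σ K} (hh : h.IsWeightedHomogeneous w (δ i)) :
    {s : K | ¬ IsParameterFamily w δ (Function.update c i (h + C s * c i))}.Finite := by
  obtain ⟨r, hr⟩ := hc.exists_hilbertFunction_le hw i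
  set J := Ideal.span (c '' {i}ᶜ) with hJ
  set U := (weightedHomogeneousSubmodule K w (r * δ i)).map (Ideal.Quotient.mkₐ K J).toLinearMap
    with hU
  have hfin := finiteDimensional_weightedHomogeneousSubmodule (K := K) hw (r * δ i)
  have hmem : ∀ a : Fin (r + 1), h ^ (a : ℕ) * c i ^ (r - a) ∈
      weightedHomogeneousSubmodule K w (r * δ i) := by
    intro a
    have h1 := (hh.pow a).mul ((hc.homogeneous i).pow (r - a))
    rw [smul_eq_mul, smul_eq_mul, ← add_mul, Nat.add_sub_cancel' (by omega)] at h1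
    exact h1
  let v : Fin (r + 1) → U := fun a => ⟨_, ⟨_, hmem a, rfl⟩⟩
  have hdep : ¬ LinearIndependent K v := by
    intro hv
    have h1 := hv.fintype_card_le_finrank
    rw [Fintype.card_fin] at h1
    exact absurd (h1.trans hr) (by omega)
  obtain ⟨α, hα, a₀, ha₀⟩ := Fintype.not_linearIndependent_iff.1 hdep
  have hrel : ∑ a : Fin (r + 1), C (α a) * (h ^ (a : ℕ) * c i ^ (r - a)) ∈ J := by
    rw [← Ideal.Quotient.eq_zero_iff_mem]
    have h1 := congrArg Subtype.val hα
    simp only [v, AddSubmonoidClass.coe_finsetSum, SetLike.val_smul, ← map_smul, ← map_sum] at h1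
    simpa only [smul_eq_C_mul] using! h1
  -- `q s` is the value of the binary form at `(h, c i) = (-s, 1)`, so it governs the common zeros
  -- of `h + s c i`.
  let q : Polynomial K :=
    ∑ a : Fin (r + 1), Polynomial.C (α a * (-1) ^ (a : ℕ)) * Polynomial.X ^ (a : ℕ)
  have hq : q ≠ 0 := by
    intro h0
    have h1 := congrArg (fun p => p.coeff (a₀ : ℕ)) h0
    simp only [q, Polynomial.finsetSum_coeff, Polynomial.coeff_C_mul, Polynomial.coeff_X_pow,
      Polynomial.coeff_zero, Fin.val_inj, mul_ite, mul_one, mul_zero,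
      Finset.sum_ite_eq, Finset.mem_univ, if_true] at h1
    exact ha₀ (by simpa using h1)
  classical
  refine (q.roots.toFinset.finite_toSet).subset fun s hs => ?_
  rw [Finset.mem_coe, Multiset.mem_toFinset, Polynomial.mem_roots hq, Polynomial.IsRoot.def]
  by_contra hne
  refine hs ⟨hc.pos, fun j => ?_, fun x hx => ?_⟩
  · rcases eq_or_ne j i with rfl | hj
    · rw [Function.update_self]
      exact hh.add ((hc.homogeneous j).C_mul s)
    · rw [Function.update_of_ne hj]
      exact hc.homogeneous j
  · have hxJ : ∀ p ∈ J, eval x p = 0 := by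
      intro p hp
      have : J ≤ RingHom.ker (eval x) := by
        rw [hJ, Ideal.span_le]
        rintro _ ⟨j, hj, rfl⟩
        have := hx j
        rwa [Function.update_of_ne hj] at this
      exact this hp
    have hxi : eval x h = -s * eval x (c i) := by
      have := hx i
      rw [Function.update_self, map_add, map_mul, eval_C] at this
      linear_combination this
    have hzero : q.eval s * eval x (c i) ^ r = 0 := by
      rw [← hxJ _ hrel, map_sum]
      simp only [q, Polynomial.eval_finsetSum, Finset.sum_mul]
      refine Finset.sum_congr rfl fun a _ => ?_
      have hpow : eval x (c i) ^ r = eval x (c i) ^ (a : ℕ) * eval x (c i) ^ (r - a) := by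
        rw [← pow_add, Nat.add_sub_cancel' (by omega)]
      rw [hpow]
      simp only [Polynomial.eval_mul, Polynomial.eval_C, Polynomial.eval_pow,
        Polynomial.eval_X, map_mul, map_pow, eval_C, hxi, mul_pow]
      rw [neg_pow s]
      ring
    have hci : eval x (c i) = 0 :=
      eq_zero_of_pow_eq_zero ((mul_eq_zero.1 hzero).resolve_left hne)
    apply hc.eq_zero_of_eval
    intro j
    rcases eq_or_ne j i with rfl | hj
    · exact hci
    · have := hx j
      rwa [Function.update_of_ne hj] at this

lemma IsParameterFamily.update_pow [DecidableEq ι] {δ : ι → ℕ} {c : ι → MvPolynomial σ K}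
    (hc : IsParameterFamily w δ c) (i : ι) {m : ℕ} (hm : 0 < m) :
    IsParameterFamily w (Function.update δ i (m * δ i)) (Function.update c i (c i ^ m)) := by
  refine ⟨fun j => ?_, fun j => ?_, fun x hx => hc.eq_zero_of_eval x fun j => ?_⟩
  all_goals rcases eq_or_ne j i with rfl | hj
  · rw [Function.update_self]
    exact Nat.mul_pos hm (hc.pos j)
  · rw [Function.update_of_ne hj]
    exact hc.pos j
  · rw [Function.update_self, Function.update_self]
    exact (hc.homogeneous j).pow m
  · rw [Function.update_of_ne hj, Function.update_of_ne hj]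
    exact hc.homogeneous j
  · have := hx j
    rw [Function.update_self, map_pow] at this
    exact eq_zero_of_pow_eq_zero this
  · have := hx j
    rwa [Function.update_of_ne hj] at this

/-- Any two members with the same index of two parameter families can be replaced, in both
families, by one and the same form. -/
lemma IsParameterFamily.exists_common_update [IsAlgClosed K] [Finite σ] [DecidableEq ι]
    {δ δ' : ι → ℕ} {c c' : ι → MvPolynomial σ K} (hc : IsParameterFamily w δ c)
    (hc' : IsParameterFamily w δ' c') (hw : ∀ i, w i ≠ 0) (i : ι) :
    ∃ (D : ℕ) (b : MvPolynomial σ K),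
      IsParameterFamily w (Function.update δ i D) (Function.update c i b) ∧
      IsParameterFamily w (Function.update δ' i D) (Function.update c' i b) := by
  -- The powers `c i ^ δ' i` and `c' i ^ δ i` have the same degree. The common form is a general
  -- member `c' i ^ δ i + s c i ^ δ' i` of their pencil, proportional to the member with parameter
  -- `s⁻¹` of the pencil taken in the other order.
  have h1 := hc.update_pow i (hc'.pos i)
  have h2 := hc'.update_pow i (hc.pos i)
  rw [mul_comm (δ i)] at h2
  have f1 := h1.finite_not_update hw i (h := c' i ^ δ i) (by
    rw [Function.update_self, mul_comm]
    exact (hc'.homogeneous i).pow _)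
  have f2 := h2.finite_not_update hw i (h := c i ^ δ' i) (by
    rw [Function.update_self]
    exact (hc.homogeneous i).pow _)
  simp only [Function.update_self, Function.update_idem] at f1 f2
  obtain ⟨s, hs⟩ := ((f1.union ((f2.image (·⁻¹)).union (Set.finite_singleton 0)))).exists_notMem
  simp only [Set.mem_union, Set.mem_ofPred_eq, Set.mem_image, Set.mem_singleton_iff, not_or,
    not_not, not_exists, not_and] at hs
  obtain ⟨hs1, hs2, hs0⟩ := hs
  have hs2' : IsParameterFamily w (Function.update δ' i (δ' i * δ i))
      (Function.update c' i (c i ^ δ' i + C s⁻¹ * c' i ^ δ i)) := by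
    by_contra h
    exact hs2 _ h (inv_inv s)
  refine ⟨_, _, hs1, ⟨hs2'.pos, fun j => ?_, fun x hx => hs2'.eq_zero_of_eval x fun j => ?_⟩⟩
  · rcases eq_or_ne j i with rfl | hj
    · simpa using hs1.homogeneous j
    · simpa [Function.update_of_ne hj] using hs2'.homogeneous j
  · have := hx j
    rcases eq_or_ne j i with rfl | hj
    · simp only [Function.update_self, map_add, map_mul, map_pow, eval_C] at this ⊢
      field_simp
      linear_combination this
    · simpa [Function.update_of_ne hj] using this

/-- Hilbert regularity passes from one parameter family to any other with the same index set:
the members are replaced one at a time by members common to both families. -/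
theorem IsHilbertRegular.of_isParameterFamily [IsAlgClosed K] [Finite σ] [Fintype ι]
    (hw : ∀ i, w i ≠ 0) {δ δ' : ι → ℕ} {c c' : ι → MvPolynomial σ K}
    (hc : IsParameterFamily w δ c) (hc' : IsParameterFamily w δ' c')
    (h : IsHilbertRegular w δ c) : IsHilbertRegular w δ' c' := by
  classical
  suffices H : ∀ (T : Finset ι) (δ δ' : ι → ℕ) (c c' : ι → MvPolynomial σ K),
      IsParameterFamily w δ c → IsParameterFamily w δ' c' →
      (∀ j, j ∉ T → δ j = δ' j ∧ c j = c' j) → IsHilbertRegular w δ c →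
      IsHilbertRegular w δ' c' from
    H Finset.univ δ δ' c c' hc hc' (fun j hj => absurd (Finset.mem_univ j) hj) h
  intro T
  induction T using Finset.induction_on with
  | empty =>
    intro δ δ' c c' _ _ heq h
    have h1 : δ = δ' := _root_.funext fun j => (heq j (Finset.notMem_empty j)).1
    have h2 : c = c' := _root_.funext fun j => (heq j (Finset.notMem_empty j)).2
    rwa [← h1, ← h2]
  | insert i T _ ih =>
    intro δ δ' c c' hc hc' heq h
    obtain ⟨D, b, hb, hb'⟩ := hc.exists_common_update hc' hw i
    have h1 : IsHilbertRegular w (Function.update δ i D) (Function.update c i b) :=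
      h.exchange_of_isParameterFamily hw hc hb i
        (fun j hj => (Function.update_of_ne hj _ _).symm)
        (fun j hj => (Function.update_of_ne hj _ _).symm)
    have h2 : IsHilbertRegular w (Function.update δ' i D) (Function.update c' i b) := by
      refine ih _ _ _ _ hb hb' (fun j hj => ?_) h1
      rcases eq_or_ne j i with rfl | hji
      · simp
      · simpa [Function.update_of_ne hji] using heq j (by simp [hji, hj])
    exact h2.exchange_of_isParameterFamily hw hb' hc' i
      (fun j hj => Function.update_of_ne hj _ _) (fun j hj => Function.update_of_ne hj _ _)

/-! ### The Hilbert series of a zero-dimensional complete intersection -/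

lemma isParameterFamily_X (hw : ∀ i, w i ≠ 0) :
    IsParameterFamily w w (X : σ → MvPolynomial σ K) where
  pos i := Nat.pos_of_ne_zero (hw i)
  homogeneous i := isWeightedHomogeneous_X K w i
  eq_zero_of_eval x hx := _root_.funext fun i => by simpa using hx i

lemma mem_span_X_image_of_X_mul_mem {T : Set σ} {i : σ} (hi : i ∉ T) {p : MvPolynomial σ K}
    (hp : X i * p ∈ Ideal.span (X '' T)) : p ∈ Ideal.span (X '' T) := by
  rw [mem_ideal_span_X_image] at hp ⊢
  intro u hu
  obtain ⟨j, hj, hne⟩ := hp (Finsupp.single i 1 + u) (by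
    rw [mem_support_iff, coeff_X_mul]
    exact mem_support_iff.1 hu)
  refine ⟨j, hj, ?_⟩
  have hij : i ≠ j := fun h => hi (h ▸ hj)
  simpa [Finsupp.single_apply, hij] using hne

/-- The variables are the starting point of the deformation: each is a non-zero-divisor modulo any
set of other variables. -/
theorem isHilbertRegular_X [Fintype σ] (hw : ∀ i, w i ≠ 0) :
    IsHilbertRegular w w (X : σ → MvPolynomial σ K) := by
  classical
  have key : ∀ T : Finset σ, (∏ i ∈ T, geomSeries (w i)) *
      hilbertSeries w (Ideal.span ((X : σ → MvPolynomial σ K) '' (T : Set σ))) =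
        hilbertSeries w (⊥ : Ideal (MvPolynomial σ K)) := by
    intro T
    induction T using Finset.induction_on with
    | empty => simp
    | insert i T hi ih =>
      obtain ⟨E, hE, hE0⟩ := exists_geomSeries_mul_hilbertSeries hw
        (isHomogeneous_span_image (isParameterFamily_X (K := K) hw).homogeneous (T : Set σ))
        (Nat.pos_of_ne_zero (hw i)) (isWeightedHomogeneous_X K w i)
      rw [hE0.2 fun p hp => mem_span_X_image_of_X_mul_mem (by simpa using hi) hp, mul_zero,
        add_zero] at hE
      rw [Finset.prod_insert hi, Finset.coe_insert, span_image_insert, ← ih, ← hE]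
      ring
  simpa [IsHilbertRegular] using key Finset.univ

lemma hilbertSeries_span_range_X (hw : ∀ i, w i ≠ 0) :
    hilbertSeries w (Ideal.span (Set.range (X : σ → MvPolynomial σ K))) = 1 := by
  classical
  set I := Ideal.span (Set.range (X : σ → MvPolynomial σ K)) with hI
  ext k
  rw [hilbertSeries, PowerSeries.coeff_mk, PowerSeries.coeff_one]
  split_ifs with hk
  · subst hk
    have hmap : (weightedHomogeneousSubmodule K w 0).map (Ideal.Quotient.mkₐ K I).toLinearMap =
        Submodule.span K {1} := by
      apply le_antisymm
      · rintro _ ⟨p, hp, rfl⟩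
        have h1 := weightedHomogeneousComponent_eq_self (w := w) (n := 0) hp
        rw [weightedHomogeneousComponent_zero _ hw] at h1
        rw [← h1, Submodule.mem_span_singleton]
        exact ⟨coeff 0 p, by rw [Algebra.smul_def, mul_one]; rfl⟩
      · rw [Submodule.span_singleton_le_iff_mem]
        exact ⟨1, isWeightedHomogeneous_one K w, map_one (Ideal.Quotient.mkₐ K I)⟩
    rw [hilbertFunction, hmap]
    apply finrank_span_singleton
    intro h
    have h1 : (1 : MvPolynomial σ K) ∈ I := Ideal.Quotient.eq_zero_iff_mem.1 h
    have h2 : I ≤ RingHom.ker (eval (0 : σ → K)) := by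
      rw [hI, Ideal.span_le]
      rintro _ ⟨i, rfl⟩
      simp
    simpa using h2 h1
  · refine hilbertFunction_eq_zero_of_le fun p hp => ?_
    rw [hI, ← Set.image_univ, mem_ideal_span_X_image]
    intro u hu
    by_contra! h
    have hu0 : u = 0 := Finsupp.ext fun i => h i (Set.mem_univ i)
    have := hp (mem_support_iff.1 hu)
    rw [hu0, map_zero] at this
    exact hk this.symm

lemma one_sub_mul_map_geomSeries {δ : ℕ} (hδ : 0 < δ) :
    (1 - PowerSeries.X ^ δ : PowerSeries ℤ) *
      (geomSeries δ).map (Nat.castRingHom ℤ) = 1 := by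
  have h := congrArg (PowerSeries.map (Nat.castRingHom ℤ)) (geomSeries_eq hδ)
  rw [map_add, map_mul, map_one, map_pow, PowerSeries.map_X] at h
  linear_combination h

/-- The Hilbert series of a graded complete intersection of dimension zero: the quotient of the
polynomial ring with variables of weights `w` by a parameter family of degrees `d` has the
polynomial Hilbert series `P = ∏ (1 - X ^ dᵢ) / ∏ (1 - X ^ wᵢ)`. -/
theorem IsParameterFamily.exists_prod_one_sub_eq [IsAlgClosed K] [Fintype σ] {d : σ → ℕ}
    {g : σ → MvPolynomial σ K} (hg : IsParameterFamily w d g) (hw : ∀ i, w i ≠ 0) :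
    ∃ P : Polynomial ℕ, ∏ i, (1 - (Polynomial.X : Polynomial ℤ) ^ d i) =
      P.map (Nat.castRingHom ℤ) * ∏ i, (1 - (Polynomial.X : Polynomial ℤ) ^ w i) := by
  have hX := isHilbertRegular_X (K := K) hw
  have hreg := hX.of_isParameterFamily hw (isParameterFamily_X hw) hg
  rw [IsHilbertRegular, hilbertSeries_span_range_X hw, mul_one] at hX
  rw [IsHilbertRegular, ← hX] at hreg
  obtain ⟨k₀, hk₀⟩ := hg.exists_forall_mem
  set H := hilbertSeries w (Ideal.span (Set.range g)) with hH
  have hP : ((H.trunc k₀ : Polynomial ℕ) : PowerSeries ℕ) = H := by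
    ext k
    rw [Polynomial.coeff_coe, PowerSeries.coeff_trunc]
    split_ifs with hk
    · rfl
    · rw [hH, hilbertSeries, PowerSeries.coeff_mk, hilbertFunction_eq_zero_of_le]
      exact hk₀ k (not_lt.1 hk)
  refine ⟨H.trunc k₀, Polynomial.coe_injective ℤ ?_⟩
  have hinv : ∀ δ : σ → ℕ, (∀ i, 0 < δ i) →
      (∏ i, (1 - PowerSeries.X ^ δ i : PowerSeries ℤ)) *
        (∏ i, geomSeries (δ i)).map (Nat.castRingHom ℤ) = 1 := by
    intro δ hδ
    rw [map_prod, ← Finset.prod_mul_distrib]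
    exact Finset.prod_eq_one fun i _ => one_sub_mul_map_geomSeries (hδ i)
  have hcoe : ∀ δ : σ → ℕ,
      ((∏ i, (1 - (Polynomial.X : Polynomial ℤ) ^ δ i) : Polynomial ℤ) : PowerSeries ℤ) =
        ∏ i, (1 - PowerSeries.X ^ δ i : PowerSeries ℤ) := by
    intro δ
    rw [← Polynomial.coeToPowerSeries.ringHom_apply, map_prod]
    simp [Polynomial.coeToPowerSeries.ringHom_apply]
  have hPmap : (((H.trunc k₀).map (Nat.castRingHom ℤ) : Polynomial ℤ) : PowerSeries ℤ) =
      H.map (Nat.castRingHom ℤ) := by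
    conv_rhs => rw [← hP]
    ext k
    simp only [Polynomial.coeff_coe, Polynomial.coeff_map, PowerSeries.coeff_map]
  rw [Polynomial.coe_mul, hcoe, hcoe, hPmap]
  have h1 := congrArg (PowerSeries.map (Nat.castRingHom ℤ)) hreg
  rw [map_mul] at h1
  have h2 := hinv d hg.pos
  have h3 := hinv w fun i => Nat.pos_of_ne_zero (hw i)
  linear_combination (∏ i, (1 - PowerSeries.X ^ w i : PowerSeries ℤ)) *
      (H.map (Nat.castRingHom ℤ)) * h2 - (∏ i, (1 - PowerSeries.X ^ d i : PowerSeries ℤ)) *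
      (∏ i, (1 - PowerSeries.X ^ w i : PowerSeries ℤ)) * h1 -
      (∏ i, (1 - PowerSeries.X ^ d i : PowerSeries ℤ)) * h3

/-! ### Symmetric forms as forms in the elementary symmetric polynomials -/

lemma isHomogeneous_esymm (σ R : Type*) [Fintype σ] [CommRing R] (k : ℕ) :
    (esymm σ R k).IsHomogeneous k := by
  rw [esymm]
  refine IsHomogeneous.sum _ _ _ fun t ht => ?_
  have h := IsHomogeneous.prod t (fun i => (X i : MvPolynomial σ R)) (fun _ => 1)
    fun i _ => isHomogeneous_X R i
  simpa [(Finset.mem_powersetCard.1 ht).2] using h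

/-- Substituting the elementary symmetric polynomials for variables of weights `1, …, n` respects
the gradings. -/
lemma homogeneousComponent_aeval_esymm {R : Type*} [CommRing R] {n : ℕ}
    (p : MvPolynomial (Fin n) R) (k : ℕ) :
    homogeneousComponent k (aeval (fun i : Fin n => esymm (Fin n) R (i + 1)) p) =
      aeval (fun i : Fin n => esymm (Fin n) R (i + 1))
        (weightedHomogeneousComponent (fun i : Fin n => (i : ℕ) + 1) k p) := by
  classical
  induction p using MvPolynomial.induction_on' with
  | add p q hp hq => simp only [map_add, hp, hq]
  | monomial u r =>
    have h1 : (monomial u r : MvPolynomial (Fin n) R).IsWeightedHomogeneous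
        (fun i : Fin n => (i : ℕ) + 1) (Finsupp.weight (fun i : Fin n => (i : ℕ) + 1) u) :=
      isWeightedHomogeneous_monomial _ u r rfl
    have h2 : (aeval (fun i : Fin n => esymm (Fin n) R (i + 1)) (monomial u r)).IsHomogeneous
        (Finsupp.weight (fun i : Fin n => (i : ℕ) + 1) u) := by
      rw [aeval_monomial, algebraMap_eq, Finsupp.weight_apply,
        Finsupp.sum_fintype _ _ (by simp), Finsupp.prod_fintype _ _ (by simp)]
      rw [← zero_add (∑ i, _)]
      refine (isHomogeneous_C _ r).mul (IsHomogeneous.prod _ _ _ fun i _ => ?_)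
      rw [smul_eq_mul, mul_comm]
      exact (isHomogeneous_esymm (Fin n) R (i + 1)).pow (u i)
    rw [weightedHomogeneousComponent_of_mem h1,
      homogeneousComponent_of_mem (mem_homogeneousSubmodule _ _ |>.2 h2)]
    split_ifs <;> simp

/-- Over an algebraically closed field the elementary symmetric polynomials take arbitrary
values, as coefficients of a monic polynomial that splits. -/
lemma exists_eval_esymm_eq {K : Type*} [Field K] [IsAlgClosed K] {n : ℕ} (y : Fin n → K) :
    ∃ x : Fin n → K, ∀ i : Fin n, eval x (esymm (Fin n) K (i + 1)) = y i := by
  classical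
  -- The monic polynomial `X ^ n + y₀ X ^ (n - 1) + ⋯ + yₙ₋₁`, whose roots are the `-xᵢ`.
  set p : Polynomial K := ∑ i : Fin n, Polynomial.C (y i.rev) * Polynomial.X ^ (i : ℕ) with hp
  have hdeg : p.degree < n := Polynomial.degree_sum_fin_lt _
  have hmonic : (Polynomial.X ^ n + p).Monic := Polynomial.monic_X_pow_add hdeg
  have hnat : (Polynomial.X ^ n + p).natDegree = n := by
    rw [Polynomial.natDegree_add_eq_left_of_degree_lt (by simpa using hdeg)]
    simp
  have hsplits := IsAlgClosed.splits (Polynomial.X ^ n + p)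
  set s := (Polynomial.X ^ n + p).roots with hs
  have hcard : s.toList.length = n := by
    rw [Multiset.length_toList, hs, ← hsplits.natDegree_eq_card_roots, hnat]
  let r : Fin n → K := fun i => s.toList.get (i.cast hcard.symm)
  have hr : Finset.univ.val.map r = s := by
    rw [Fin.univ_val_map]
    conv_rhs => rw [← Multiset.coe_toList s]
    congr 1
    apply List.ext_get
    · simp [hcard]
    · intro i h1 h2
      simp [r]
  have hprod : Polynomial.X ^ n + p = ∏ i, (Polynomial.X + Polynomial.C (-r i)) := by
    rw [hsplits.eq_prod_roots_of_monic hmonic, ← hs, ← hr, Multiset.map_map]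
    simp [Finset.prod, sub_eq_add_neg]
  refine ⟨fun i => -r i, fun i => ?_⟩
  have hcoeff : (Polynomial.X ^ n + p).coeff (i.rev : ℕ) = y i := by
    rw [Polynomial.coeff_add, Polynomial.coeff_X_pow, if_neg i.rev.isLt.ne, zero_add, hp,
      Polynomial.finsetSum_coeff]
    simp only [Polynomial.coeff_C_mul, Polynomial.coeff_X_pow, Fin.val_inj, mul_ite, mul_one,
      mul_zero, Finset.sum_ite_eq, Finset.mem_univ, if_true, Fin.rev_rev]
  rw [← hcoeff, hprod, Finset.prod_X_add_C_coeff _ _ (by simp)]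
  have hsub : Finset.card (Finset.univ : Finset (Fin n)) - (i.rev : ℕ) = i + 1 := by
    rw [Finset.card_fin, Fin.val_rev]
    omega
  rw [hsub, esymm, map_sum]
  simp

/-- A maximal regular sequence of symmetric forms, written in the elementary symmetric
polynomials, is a parameter family in the polynomial ring with weights `1, …, n`. -/
lemma exists_isParameterFamily_of_isRegularDegreeSequence {n : ℕ} {d : Fin n → ℕ}
    (hd : IsRegularDegreeSequence d) :
    ∃ g : Fin n → MvPolynomial (Fin n) ℂ,
      IsParameterFamily (fun i : Fin n => (i : ℕ) + 1) d g := by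
  obtain ⟨hpos, f, hsymm, hf⟩ := hd
  have hbij := esymmAlgHom_fin_bijective ℂ n
  have hex : ∀ j, ∃ p : MvPolynomial (Fin n) ℂ,
      aeval (fun i : Fin n => esymm (Fin n) ℂ (i + 1)) p = f j := by
    intro j
    obtain ⟨p, hp⟩ := hbij.2 ⟨f j, hsymm j⟩
    exact ⟨p, by rw [← esymmAlgHom_apply, hp]⟩
  have hinj : ∀ p : MvPolynomial (Fin n) ℂ,
      aeval (fun i : Fin n => esymm (Fin n) ℂ (i + 1)) p = 0 → p = 0 := by
    intro p hp
    apply hbij.1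
    apply Subtype.ext
    rw [esymmAlgHom_apply, hp, map_zero]
    rfl
  choose g hg using hex
  refine ⟨g, hpos, fun j => ?_, fun y hy => ?_⟩
  · have h : weightedHomogeneousComponent (fun i : Fin n => (i : ℕ) + 1) (d j) (g j) = g j := by
      rw [← sub_eq_zero]
      apply hinj
      rw [map_sub, ← homogeneousComponent_aeval_esymm, hg,
        homogeneousComponent_of_mem (mem_homogeneousSubmodule _ _ |>.2 (hf.homogeneous j)),
        if_pos rfl, sub_self]
    rw [← h]
    exact weightedHomogeneousComponent_isWeightedHomogeneous _ _
  · obtain ⟨x, hx⟩ := exists_eval_esymm_eq y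
    have hx0 : x = 0 := by
      refine (hf.common_zero x).1 fun j => ?_
      have h1 : (eval x).comp (aeval fun i : Fin n => esymm (Fin n) ℂ (i + 1)).toRingHom =
          eval y := by
        ext i
        · simp
        · simp [hx]
      rw [← hg j, ← hy j, ← h1]
      rfl
    funext i
    rw [← hx i, hx0]
    exact ((isHomogeneous_esymm (Fin n) ℂ (i + 1))).eval_zero_eq_zero (Nat.succ_pos _)

end MvPolynomial

/-! ### Divisibility of degrees and roots of unity -/

open Polynomial in
lemma count_roots_one_sub_X_pow {i : ℕ} {ζ : ℂ} (hζ : IsPrimitiveRoot ζ i) {δ : ℕ} (hδ : 0 < δ) :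
    (1 - X ^ δ : ℂ[X]).roots.count ζ = if i ∣ δ then 1 else 0 := by
  have h : (1 - X ^ δ : ℂ[X]).roots = nthRoots δ 1 := by
    rw [nthRoots, ← roots_neg, neg_sub, C_1]
  rw [h, Multiset.count_eq_of_nodup
    (Complex.isPrimitiveRoot_exp δ hδ.ne').nthRoots_one_nodup]
  simp only [mem_nthRoots hδ, hζ.pow_eq_one_iff_dvd]

open Polynomial in
lemma count_roots_prod_one_sub_X_pow {i : ℕ} {ζ : ℂ} (hζ : IsPrimitiveRoot ζ i) {n : ℕ}
    {δ : Fin n → ℕ} (hδ : ∀ j, 0 < δ j) :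
    (∏ j, (1 - X ^ δ j : ℂ[X])).roots.count ζ = degreeBeta δ i := by
  have hne : ∏ j, (1 - X ^ δ j : ℂ[X]) ≠ 0 := Finset.prod_ne_zero_iff.2 fun j _ => by
    rw [← neg_ne_zero, neg_sub]
    exact X_pow_sub_C_ne_zero (hδ j) 1
  rw [roots_prod _ _ hne, Multiset.count_bind, degreeBeta, Finset.card_filter]
  simp only [count_roots_one_sub_X_pow hζ (hδ _)]
  rfl

lemma degreeBeta_val_add_one (n i : ℕ) : degreeBeta (fun j : Fin n => (j : ℕ) + 1) i = n / i := by
  rw [degreeBeta, ← Nat.card_multiples, Finset.card_filter, Finset.card_filter,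
    ← Fin.sum_univ_eq_sum_range (fun j => if i ∣ j + 1 then 1 else 0)]

/-! ### Degrees of regular sequences of symmetric forms -/

open Polynomial in
theorem proposition2p2 (n : ℕ) (d : Fin n → ℕ) (hd : IsRegularDegreeSequence d) :
    (∃ P : Polynomial ℕ,
      (∏ j : Fin n, (1 - (RatFunc.X : RatFunc ℚ) ^ d j) / (1 - RatFunc.X ^ ((j : ℕ) + 1))) =
        algebraMap (Polynomial ℚ) (RatFunc ℚ) (P.map (Nat.castRingHom ℚ))) ∧
    (∀ i : ℕ, 1 ≤ i → n / i ≤ degreeBeta d i) ∧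
    n.factorial ∣ ∏ j : Fin n, d j := by
  have hpos := hd.1
  obtain ⟨g, hg⟩ := MvPolynomial.exists_isParameterFamily_of_isRegularDegreeSequence hd
  obtain ⟨P, hP⟩ := hg.exists_prod_one_sub_eq fun i => Nat.succ_ne_zero i
  refine ⟨⟨P, ?_⟩, fun i hi => ?_, ?_⟩
  · have h := congrArg (fun p => algebraMap ℚ[X] (RatFunc ℚ) (p.map (Int.castRingHom ℚ))) hP
    simp only [Polynomial.map_mul, Polynomial.map_prod, Polynomial.map_sub, Polynomial.map_one,
      Polynomial.map_pow, Polynomial.map_X, Polynomial.map_map, map_mul, map_prod, map_sub,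
      map_one, map_pow, RatFunc.algebraMap_X] at h
    have hne : ∏ j : Fin n, (1 - (RatFunc.X : RatFunc ℚ) ^ ((j : ℕ) + 1)) ≠ 0 :=
      Finset.prod_ne_zero_iff.2 fun j _ => by
        have h1 : (1 - X ^ ((j : ℕ) + 1) : ℚ[X]) ≠ 0 := by
          rw [← neg_ne_zero, neg_sub]
          exact X_pow_sub_C_ne_zero (Nat.succ_pos _) 1
        have h2 := (map_ne_zero_iff _ (RatFunc.algebraMap_injective ℚ)).2 h1
        simpa using h2
    rw [Finset.prod_div_distrib, div_eq_iff hne, h,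
      Subsingleton.elim ((Int.castRingHom ℚ).comp (Nat.castRingHom ℤ)) (Nat.castRingHom ℚ)]
  · have hζ := Complex.isPrimitiveRoot_exp i (by omega)
    have h := congrArg (fun p => p.map (Int.castRingHom ℂ)) hP
    simp only [Polynomial.map_mul, Polynomial.map_prod, Polynomial.map_sub, Polynomial.map_one,
      Polynomial.map_pow, Polynomial.map_X] at h
    have hne : ∏ j, (1 - X ^ d j : ℂ[X]) ≠ 0 := Finset.prod_ne_zero_iff.2 fun j _ => by
      rw [← neg_ne_zero, neg_sub]
      exact X_pow_sub_C_ne_zero (hpos j) 1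
    rw [← degreeBeta_val_add_one, ← count_roots_prod_one_sub_X_pow hζ hpos,
      ← count_roots_prod_one_sub_X_pow hζ fun j => Nat.succ_pos _, h,
      roots_mul (h ▸ hne), Multiset.count_add]
    exact Nat.le_add_left _ _
  · have hfac : ∀ δ : Fin n → ℕ, ∏ j, (1 - (X : ℤ[X]) ^ δ j) =
        (1 - X) ^ n * ∏ j, ∑ k ∈ Finset.range (δ j), X ^ k := by
      intro δ
      simp only [← mul_neg_geom_sum, Finset.prod_mul_distrib, Finset.prod_const,
        Finset.card_univ, Fintype.card_fin]
    rw [hfac, hfac, mul_left_comm] at hP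
    have hne : (1 - X : ℤ[X]) ≠ 0 := by
      rw [← neg_ne_zero, neg_sub]
      exact X_sub_C_ne_zero 1
    have h := congrArg (eval 1) (mul_left_cancel₀ (pow_ne_zero n hne) hP)
    simp only [eval_mul, eval_prod, eval_finsetSum, eval_pow, eval_X, one_pow, Finset.sum_const,
      Finset.card_range, nsmul_eq_mul, mul_one] at h
    rw [← Int.natCast_dvd_natCast]
    refine ⟨(P.map (Nat.castRingHom ℤ)).eval 1, ?_⟩
    rw [← Finset.prod_range_add_one_eq_factorial, ← Fin.prod_univ_eq_prod_range (· + 1)]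
    push_cast
    rw [h, mul_comm]
    push_cast
    rfl
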